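/- Let $c_0$ be the real Banach space of null sequences with the supremum norm, with canonical vectors $(e_k)_{k\ge 1}$. For a continuous bilinear form $A\colon c_0\times c_0\to\mathbb{R}$ put $\|A\|=\sup\{|A(x,y)| : \|x\|\le 1,\ \|y\|\le 1\}$. Let $a,b\in[1,\infty]$ with $\frac1a+\frac1b\le\frac32$, where $1/\infty=0$. Then for every continuous bilinear form $A\colon c_0\times c_0\to\mathbb{R}$, $$\Bigl(\sum_{k=1}^\infty\Bigl(\sum_{j=1}^\infty|A(e_k,e_j)|^a\Bigr)^{b/a}\Bigr)^{1/b}\le 2^{\max\{0,\frac1a+\frac1b-1\}}\,\|A\|,$$ where for $p=\infty$ the expression $\bigl(\sum_i|x_i|^p\bigr)^{1/p}$ means $\sup_i|x_i|$ (applied to the inner expression when $a=\infty$ and to the outer one when $b=\infty$). Moreover, for each such pair $(a,b)$ the constant is optimal: if $C\in\mathbb{R}$ is such that $$\Bigl(\sum_{k=1}^\infty\Bigl(\sum_{j=1}^\infty|A(e_k,e_j)|^a\Bigr)^{b/a}\Bigr)^{1/b}\le C\,\|A\|$$ for every continuous bilinear form $A\colon c_0\times c_0\to\mathbb{R}$,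 then $C\ge 2^{\max\{0,\frac1a+\frac1b-1\}}$. -/

import Mathlib

open scoped ENNReal ZeroAtInfty

noncomputable section

/-- The real Banach space of null sequences with the supremum norm (`ℕ` is discrete, so vanishing
at infinity means tending to `0`). Indices start at `0`. -/
def NullSeq : Type := C₀(ℕ, ℝ)

instance : NormedAddCommGroup NullSeq := inferInstanceAs (NormedAddCommGroup C₀(ℕ, ℝ))

instance : NormedSpace ℝ NullSeq := inferInstanceAs (NormedSpace ℝ C₀(ℕ, ℝ))

instance : FunLike NullSeq ℕ ℝ := inferInstanceAs (FunLike C₀(ℕ, ℝ) ℕ ℝ)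

/-- Continuous bilinear forms `c₀ × c₀ → ℝ`, in curried form. The norm `‖A‖` is the operator norm,
that is, the supremum of `|A x y|` over `‖x‖ ≤ 1` and `‖y‖ ≤ 1`. -/
abbrev BilinForm : Type := NullSeq →L[ℝ] NullSeq →L[ℝ] ℝ

/-- The canonical vector `e k` of `c₀`: `1` in position `k` and `0` elsewhere. -/
def canonicalVec (k : ℕ) : NullSeq := show C₀(ℕ, ℝ) from {
  toFun := Pi.single k 1
  continuous_toFun := continuous_of_discreteTopology
  zero_at_infty' := by
    rw [Filter.cocompact_eq_cofinite, Nat.cofinite_eq_atTop]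
    refine tendsto_const_nhds.congr' ?_
    filter_upwards [Filter.eventually_gt_atTop k] with n hn
    simp [hn.ne'] }

/-- `(∑ j, x j ^ p) ^ (1 / p)` for `p < ∞`, and `sup x j` for `p = ∞`; the value may be `∞`.
Only used for `1 ≤ p`. -/
def seqNorm (p : ℝ≥0∞) (x : ℕ → ℝ≥0∞) : ℝ≥0∞ :=
  if p = ∞ then ⨆ j, x j else (∑' j, x j ^ p.toReal) ^ (1 / p.toReal)

/-- `(∑ k, (∑ j, |A (e k) (e j)| ^ a) ^ (b / a)) ^ (1 / b)`, with suprema in place of the sums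
whose exponent is `∞`. -/
def mixedNorm (a b : ℝ≥0∞) (A : BilinForm) : ℝ≥0∞ :=
  seqNorm b fun k => seqNorm a fun j => ENNReal.ofReal |A (canonicalVec k) (canonicalVec j)|

/-- `2 ^ max {0, 1/a + 1/b - 1}`, with `1/∞ = 0`. -/
def littlewoodConst (a b : ℝ≥0∞) : ℝ :=
  2 ^ max 0 ((a⁻¹).toReal + (b⁻¹).toReal - 1)

end

/-! Upper bound: for `r ≥ 2` a finite real sequence satisfies `‖x‖_r ≤ 2^(1/r) E|∑ ±x i|`. This
follows from `max |x i| ≤ E|∑ ±x i|` and the sharp Khinchine inequality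
`sum_sq_le_two_mul_sq_cubeAvg`, proved by the spectral argument of Latała and Oleszkiewicz. Applied
to the rows of `A`, whose signed sums have `ℓ¹` norm at most `‖A‖`, it bounds the `(r, 1)` mixed
norm by `2^(1/r) ‖A‖`; transposition and Minkowski give `(1, r)`. Hölder interpolation with `1/r =
1/a + 1/b - 1` yields `mixedNorm_le_of_one_le`. When `1/a + 1/b < 1`, decreasing `b` to the
conjugate exponent of `a` reduces to constant `1`. Optimality: a rank-one form forces `C ≥ 1`, and
the 2×2 Hadamard form forces the power of two. -/

/-! ### Analysis on the discrete cube -/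

/-- The sign `±1` encoded by a Boolean. -/
def boolSign (b : Bool) : ℝ := if b then 1 else -1

@[simp] theorem boolSign_true : boolSign true = 1 := rfl

@[simp] theorem boolSign_false : boolSign false = -1 := rfl

@[simp] theorem boolSign_not (b : Bool) : boolSign (!b) = -boolSign b := by cases b <;> simp

@[simp] theorem abs_boolSign (b : Bool) : |boolSign b| = 1 := by cases b <;> simp

/-- The average of a function over the discrete cube. -/
noncomputable def cubeAvg {n : ℕ} (f : (Fin n → Bool) → ℝ) : ℝ := (∑ ε, f ε) / 2 ^ n

theorem cubeAvg_zero (f : (Fin 0 → Bool) → ℝ) : cubeAvg f = f ![] := by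
  simp only [cubeAvg, Fintype.sum_unique, pow_zero, div_one]
  exact congrArg f (Subsingleton.elim _ _)

theorem cubeAvg_succ {n : ℕ} (f : (Fin (n + 1) → Bool) → ℝ) :
    cubeAvg f = (cubeAvg (fun ε => f (Fin.cons true ε)) +
      cubeAvg fun ε => f (Fin.cons false ε)) / 2 := by
  unfold cubeAvg
  rw [← (Fin.consEquiv fun _ : Fin (n + 1) => Bool).sum_comp, Fintype.sum_prod_type,
    Fintype.sum_bool, pow_succ]
  change (∑ ε, f (Fin.cons true ε) + ∑ ε, f (Fin.cons false ε)) / _ = _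
  field_simp

theorem cubeAvg_mono {n : ℕ} {f g : (Fin n → Bool) → ℝ} (h : ∀ ε, f ε ≤ g ε) :
    cubeAvg f ≤ cubeAvg g := by
  unfold cubeAvg
  gcongr
  exact h _

theorem cubeAvg_add {n : ℕ} (f g : (Fin n → Bool) → ℝ) :
    cubeAvg (fun ε => f ε + g ε) = cubeAvg f + cubeAvg g := by
  simp only [cubeAvg, Finset.sum_add_distrib, add_div]

theorem cubeAvg_sub {n : ℕ} (f g : (Fin n → Bool) → ℝ) :
    cubeAvg (fun ε => f ε - g ε) = cubeAvg f - cubeAvg g := by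
  simp only [cubeAvg, Finset.sum_sub_distrib, sub_div]

theorem cubeAvg_const_mul {n : ℕ} (c : ℝ) (f : (Fin n → Bool) → ℝ) :
    cubeAvg (fun ε => c * f ε) = c * cubeAvg f := by
  simp only [cubeAvg, ← Finset.mul_sum, mul_div_assoc]

theorem cubeAvg_sum {n : ℕ} {ι : Type*} (s : Finset ι) (f : ι → (Fin n → Bool) → ℝ) :
    cubeAvg (fun ε => ∑ i ∈ s, f i ε) = ∑ i ∈ s, cubeAvg (f i) := by
  simp only [cubeAvg]
  rw [Finset.sum_comm, Finset.sum_div]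

theorem cubeAvg_const {n : ℕ} (c : ℝ) : cubeAvg (fun _ : Fin n → Bool => c) = c := by
  simp [cubeAvg]

theorem cubeAvg_not {n : ℕ} (f : (Fin n → Bool) → ℝ) :
    cubeAvg (fun ε => f fun i => !ε i) = cubeAvg f := by
  unfold cubeAvg
  congr 1
  exact (Equiv.piCongrRight fun _ : Fin n => Equiv.boolNot).sum_comp f

theorem cubeAvg_flip {n : ℕ} (f : (Fin n → Bool) → ℝ) (i : Fin n) :
    cubeAvg (fun ε => f (Function.update ε i (!ε i))) = cubeAvg f := by
  unfold cubeAvg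
  congr 1
  refine Function.Bijective.sum_comp (Function.Involutive.bijective fun ε => ?_) f
  simp

theorem sq_cubeAvg_le {n : ℕ} (f : (Fin n → Bool) → ℝ) :
    cubeAvg f ^ 2 ≤ cubeAvg fun ε => f ε ^ 2 := by
  have h := cubeAvg_mono (n := n) (f := fun _ => 0) (g := fun ε => (f ε - cubeAvg f) ^ 2)
    fun ε => sq_nonneg _
  have h' : (fun ε => (f ε - cubeAvg f) ^ 2) =
      fun ε => (f ε ^ 2 - (2 * cubeAvg f) * f ε) + cubeAvg f ^ 2 := by
    ext ε; ring
  rw [h', cubeAvg_add, cubeAvg_sub, cubeAvg_const_mul, cubeAvg_const, cubeAvg_const] at h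
  nlinarith

/-- The Dirichlet form of the discrete cube. -/
noncomputable def dirichletForm {n : ℕ} (f : (Fin n → Bool) → ℝ) : ℝ :=
  ∑ i, cubeAvg fun ε => ((f ε - f (Function.update ε i (!ε i))) / 2) ^ 2

theorem dirichletForm_succ {n : ℕ} (f : (Fin (n + 1) → Bool) → ℝ) :
    dirichletForm f = (dirichletForm (fun ε => f (Fin.cons true ε)) +
      dirichletForm fun ε => f (Fin.cons false ε)) / 2 +
      cubeAvg fun ε => ((f (Fin.cons true ε) - f (Fin.cons false ε)) / 2) ^ 2 := by
  unfold dirichletForm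
  rw [Fin.sum_univ_succ, add_comm, ← Finset.sum_add_distrib, Finset.sum_div]
  congr 1
  · refine Finset.sum_congr rfl fun i _ => ?_
    rw [cubeAvg_succ]
    simp only [Fin.cons_update, Fin.cons_succ]
  · rw [cubeAvg_succ]
    simp only [Fin.update_cons_zero, Fin.cons_zero, Bool.not_true, Bool.not_false]
    rw [← cubeAvg_add, ← mul_one_div, mul_comm, ← cubeAvg_const_mul]
    congr 1
    ext ε
    ring

theorem dirichletForm_parallelogram {n : ℕ} (f g : (Fin n → Bool) → ℝ) :
    (dirichletForm f + dirichletForm g) / 2 =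
      dirichletForm (fun ε => (f ε + g ε) / 2) + dirichletForm fun ε => (f ε - g ε) / 2 := by
  unfold dirichletForm
  rw [← Finset.sum_add_distrib, ← Finset.sum_add_distrib, Finset.sum_div]
  refine Finset.sum_congr rfl fun i _ => ?_
  rw [← cubeAvg_add, ← cubeAvg_add, ← mul_one_div, mul_comm, ← cubeAvg_const_mul]
  congr 1
  ext ε
  ring

/-- Flipping a coordinate preserves the average, so `f ^ 2` and its flip cancel after the square is
expanded. -/
theorem dirichletForm_eq {n : ℕ} (f : (Fin n → Bool) → ℝ) :
    dirichletForm f =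
      cubeAvg fun ε => f ε * ∑ i, (f ε - f (Function.update ε i (!ε i))) / 2 := by
  simp only [Finset.mul_sum]
  rw [cubeAvg_sum]
  refine Finset.sum_congr rfl fun i _ => ?_
  have h := cubeAvg_flip (fun ε => f ε ^ 2 / 4) i
  have e : (fun ε => ((f ε - f (Function.update ε i (!ε i))) / 2) ^ 2) = fun ε =>
      (f ε * ((f ε - f (Function.update ε i (!ε i))) / 2) - f ε ^ 2 / 4) +
        f (Function.update ε i (!ε i)) ^ 2 / 4 := by
    ext ε; ring
  rw [e, cubeAvg_add, cubeAvg_sub, h]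
  ring

/-- The Poincaré inequality on the discrete cube. -/
theorem variance_le_dirichletForm {n : ℕ} (f : (Fin n → Bool) → ℝ) :
    cubeAvg (fun ε => f ε ^ 2) - cubeAvg f ^ 2 ≤ dirichletForm f := by
  induction n with
  | zero => simp [cubeAvg_zero, dirichletForm]
  | succ n ih =>
    have h₁ := ih fun ε => f (Fin.cons true ε)
    have h₂ := ih fun ε => f (Fin.cons false ε)
    have h₃ := sq_cubeAvg_le fun ε => (1 / 2) * (f (Fin.cons true ε) - f (Fin.cons false ε))
    rw [cubeAvg_const_mul, cubeAvg_sub] at h₃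
    have e : (fun ε : Fin n → Bool => (1 / 2 * (f (Fin.cons true ε) - f (Fin.cons false ε))) ^ 2) =
        fun ε => ((f (Fin.cons true ε) - f (Fin.cons false ε)) / 2) ^ 2 := by
      ext ε; ring
    rw [e] at h₃
    rw [dirichletForm_succ, cubeAvg_succ, cubeAvg_succ f]
    nlinarith

/-- The spectral gap of the discrete cube is doubled off the first level. -/
theorem two_mul_variance_le {n : ℕ} (f : (Fin n → Bool) → ℝ) :
    2 * (cubeAvg (fun ε => f ε ^ 2) - cubeAvg f ^ 2) ≤
      dirichletForm f + ∑ i, cubeAvg (fun ε => boolSign (ε i) * f ε) ^ 2 := by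
  induction n with
  | zero => simp [cubeAvg_zero, dirichletForm]
  | succ n ih =>
    -- Here `f = g ± h`, with the sign of the first coordinate. That factor raises levels by one, so
    -- the plain Poincaré inequality suffices for `h`.
    set g : (Fin n → Bool) → ℝ := fun ε => (f (Fin.cons true ε) + f (Fin.cons false ε)) / 2 with hg
    set h : (Fin n → Bool) → ℝ := fun ε => (f (Fin.cons true ε) - f (Fin.cons false ε)) / 2 with hh
    have h₁ := ih g
    have h₂ := variance_le_dirichletForm h
    have avg (F : (Fin n → Bool) → ℝ) (u v : (Fin n → Bool) → ℝ)
        (hF : ∀ ε, F ε = (u ε + v ε) / 2) : (cubeAvg u + cubeAvg v) / 2 = cubeAvg F := by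
      rw [← cubeAvg_add, ← mul_one_div, mul_comm, ← cubeAvg_const_mul]
      congr 1
      ext ε
      rw [hF]; ring
    have e₀ : cubeAvg f = cubeAvg g := by
      rw [cubeAvg_succ]
      exact avg _ _ _ fun ε => rfl
    have e₁ : cubeAvg (fun ε => f ε ^ 2) =
        cubeAvg (fun ε => g ε ^ 2) + cubeAvg fun ε => h ε ^ 2 := by
      rw [cubeAvg_succ, ← cubeAvg_add (n := n) (fun ε => g ε ^ 2)]
      exact avg _ _ _ fun ε => by simp only [hg, hh]; ring
    have e₂ : dirichletForm f =
        dirichletForm g + dirichletForm h + cubeAvg fun ε => h ε ^ 2 := by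
      rw [dirichletForm_succ, dirichletForm_parallelogram]
    have e₃ : ∑ i, cubeAvg (fun ε => boolSign (ε i) * f ε) ^ 2 =
        cubeAvg h ^ 2 + ∑ i, cubeAvg (fun ε => boolSign (ε i) * g ε) ^ 2 := by
      rw [Fin.sum_univ_succ]
      congr 2
      · rw [cubeAvg_succ]
        exact avg _ _ _ fun ε => by simp only [hh, Fin.cons_zero, boolSign_true, boolSign_false]; ring
      · ext i
        rw [cubeAvg_succ]
        congr 1
        exact avg _ _ _ fun ε => by simp only [hg, Fin.cons_succ]; ring
    rw [e₀, e₁, e₂, e₃]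
    linarith

/-! ### Khinchine inequalities -/

/-- The Rademacher sum `∑ i, ± x i`. -/
noncomputable def rademacherSum {n : ℕ} (x : Fin n → ℝ) (ε : Fin n → Bool) : ℝ :=
  ∑ i, boolSign (ε i) * x i

theorem rademacherSum_not {n : ℕ} (x : Fin n → ℝ) (ε : Fin n → Bool) :
    rademacherSum x (fun i => !ε i) = -rademacherSum x ε := by
  simp [rademacherSum]

theorem rademacherSum_flip {n : ℕ} (x : Fin n → ℝ) (ε : Fin n → Bool) (i : Fin n) :
    rademacherSum x (Function.update ε i (!ε i)) =
      rademacherSum x ε - 2 * (boolSign (ε i) * x i) := by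
  unfold rademacherSum
  rw [← Finset.add_sum_erase _ _ (Finset.mem_univ i),
    ← Finset.add_sum_erase _ (fun j => boolSign (ε j) * x j) (Finset.mem_univ i),
    Finset.sum_congr rfl (g := fun j => boolSign (ε j) * x j)]
  · simp; ring
  · intro j hj
    rw [Function.update_of_ne (Finset.ne_of_mem_erase hj)]

theorem cubeAvg_sq_rademacherSum {n : ℕ} (x : Fin n → ℝ) :
    cubeAvg (fun ε => rademacherSum x ε ^ 2) = ∑ i, x i ^ 2 := by
  induction n with
  | zero => simp [cubeAvg_zero, rademacherSum]
  | succ n ih =>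
    rw [cubeAvg_succ, Fin.sum_univ_succ, ← ih, ← cubeAvg_const (n := n) (x 0 ^ 2), ← cubeAvg_add,
      ← cubeAvg_add, ← mul_one_div, mul_comm, ← cubeAvg_const_mul]
    congr 1
    ext ε
    simp only [rademacherSum, Fin.sum_univ_succ, Fin.cons_zero, Fin.cons_succ, boolSign_true,
      boolSign_false]
    ring

/-- Khinchine's inequality between the first and the second moment, with the optimal constant. -/
theorem sum_sq_le_two_mul_sq_cubeAvg {n : ℕ} (x : Fin n → ℝ) :
    ∑ i, x i ^ 2 ≤ 2 * cubeAvg (fun ε => |rademacherSum x ε|) ^ 2 := by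
  have h := two_mul_variance_le fun ε => |rademacherSum x ε|
  -- `|rademacherSum x|` is even, so its first level vanishes.
  have hodd (i : Fin n) : cubeAvg (fun ε => boolSign (ε i) * |rademacherSum x ε|) = 0 := by
    have h := cubeAvg_not fun ε => boolSign (ε i) * |rademacherSum x ε|
    have e : (fun ε : Fin n → Bool =>
        boolSign (!ε i) * |rademacherSum x fun i => !ε i|) =
        fun ε => (-1) * (boolSign (ε i) * |rademacherSum x ε|) := by
      ext ε
      rw [rademacherSum_not, abs_neg, boolSign_not]
      ring
    rw [e, cubeAvg_const_mul] at h
    linarith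
  have hL : dirichletForm (fun ε => |rademacherSum x ε|) ≤ ∑ i, x i ^ 2 := by
    rw [dirichletForm_eq, ← cubeAvg_sq_rademacherSum]
    refine cubeAvg_mono fun ε => ?_
    rw [← sq_abs, sq]
    refine mul_le_mul_of_nonneg_left ?_ (abs_nonneg _)
    -- The `n` single flips of the sum `S` add up to `(n - 2) S`; the triangle inequality then
    -- bounds half the total drop of `|S|` under flips by `|S|`.
    have h₁ : |∑ i, (rademacherSum x ε - 2 * (boolSign (ε i) * x i))| ≤
        ∑ i, |rademacherSum x (Function.update ε i (!ε i))| := by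
      simp only [rademacherSum_flip]
      exact Finset.abs_sum_le_sum_abs _ _
    rw [Finset.sum_sub_distrib, ← Finset.mul_sum] at h₁
    change |_ - 2 * rademacherSum x ε| ≤ _ at h₁
    have h₂ : ((n : ℝ) - 2) * |rademacherSum x ε| ≤
        |(∑ _i : Fin n, rademacherSum x ε) - 2 * rademacherSum x ε| := by
      simp only [Finset.sum_const, Finset.card_univ, Fintype.card_fin, nsmul_eq_mul]
      rw [← sub_mul, abs_mul]
      exact mul_le_mul_of_nonneg_right (le_abs_self _) (abs_nonneg _)
    rw [← Finset.sum_div, Finset.sum_sub_distrib]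
    simp only [Finset.sum_const, Finset.card_univ, Fintype.card_fin, nsmul_eq_mul]
    linarith
  simp only [hodd, sq_abs, cubeAvg_sq_rademacherSum] at h
  simp only [ne_eq, OfNat.ofNat_ne_zero, not_false_eq_true, zero_pow, Finset.sum_const_zero] at h
  linarith

/-- A sum and its flip at `i` differ by `2 |x i|` in modulus and have the same average modulus. -/
theorem abs_le_cubeAvg_abs_rademacherSum {n : ℕ} (x : Fin n → ℝ) (i : Fin n) :
    |x i| ≤ cubeAvg fun ε => |rademacherSum x ε| := by
  have h := cubeAvg_flip (fun ε => |rademacherSum x ε|) i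
  have h' := cubeAvg_mono (f := fun _ => 2 * |x i|)
    (g := fun ε => |rademacherSum x ε| + |rademacherSum x (Function.update ε i (!ε i))|) fun ε => by
      have := abs_sub (rademacherSum x ε) (rademacherSum x (Function.update ε i (!ε i)))
      rw [rademacherSum_flip] at this ⊢
      rw [show rademacherSum x ε - (rademacherSum x ε - 2 * (boolSign (ε i) * x i)) =
        2 * (boolSign (ε i) * x i) by ring, abs_mul, abs_mul, abs_boolSign] at this
      simpa using this
  rw [cubeAvg_add, h, cubeAvg_const] at h'
  linarith

/-- Since `|x i| ≤ E`, the excess power `r - 2` is absorbed into `E`, leaving the case `r = 2`. -/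
theorem sum_rpow_le_two_mul_rpow_cubeAvg {n : ℕ} (x : Fin n → ℝ) {r : ℝ} (hr : 2 ≤ r) :
    ∑ i, |x i| ^ r ≤ 2 * cubeAvg (fun ε => |rademacherSum x ε|) ^ r := by
  set E := cubeAvg fun ε => |rademacherSum x ε| with hE
  have hE0 : 0 ≤ E := by
    rw [← cubeAvg_const (n := n) 0]
    exact cubeAvg_mono fun ε => abs_nonneg _
  have split (t : ℝ) (ht : 0 ≤ t) : t ^ r = t ^ (r - 2) * t ^ 2 := by
    rw [← Real.rpow_two, ← Real.rpow_add_of_nonneg ht (by linarith) (by norm_num)]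
    simp
  calc ∑ i, |x i| ^ r ≤ ∑ i, E ^ (r - 2) * x i ^ 2 := by
        refine Finset.sum_le_sum fun i _ => ?_
        rw [split _ (abs_nonneg _), sq_abs]
        have := abs_le_cubeAvg_abs_rademacherSum x i
        gcongr
    _ ≤ E ^ (r - 2) * (2 * E ^ 2) := by
        rw [← Finset.mul_sum]
        exact mul_le_mul_of_nonneg_left (sum_sq_le_two_mul_sq_cubeAvg x) (by positivity)
    _ = 2 * E ^ r := by rw [split E hE0]; ring

/-! ### Inequalities for `ℓᵖ` norms -/

theorem seqNorm_top (x : ℕ → ℝ≥0∞) : seqNorm ∞ x = ⨆ j, x j := if_pos rfl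

theorem seqNorm_of_ne_top {p : ℝ≥0∞} (hp : p ≠ ∞) (x : ℕ → ℝ≥0∞) :
    seqNorm p x = (∑' j, x j ^ p.toReal) ^ (1 / p.toReal) := if_neg hp

theorem seqNorm_one (x : ℕ → ℝ≥0∞) : seqNorm 1 x = ∑' j, x j := by
  simp [seqNorm_of_ne_top]

theorem seqNorm_mono (p : ℝ≥0∞) {x y : ℕ → ℝ≥0∞} (h : ∀ j, x j ≤ y j) :
    seqNorm p x ≤ seqNorm p y := by
  unfold seqNorm
  split_ifs
  · exact iSup_mono h
  · refine ENNReal.rpow_le_rpow (ENNReal.tsum_le_tsum fun j => ?_) (by positivity)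
    exact ENNReal.rpow_le_rpow (h j) (by positivity)

theorem le_seqNorm {p : ℝ≥0∞} (hp : 1 ≤ p) (x : ℕ → ℝ≥0∞) (j : ℕ) : x j ≤ seqNorm p x := by
  rcases eq_or_ne p ∞ with rfl | hp'
  · rw [seqNorm_top]
    exact le_iSup x j
  · have hp0 : 0 < p.toReal := ENNReal.toReal_pos (zero_lt_one.trans_le hp).ne' hp'
    rw [seqNorm_of_ne_top hp', one_div, ENNReal.le_rpow_inv_iff hp0]
    exact ENNReal.le_tsum (f := fun j => x j ^ p.toReal) j

theorem seqNorm_iSup {p : ℝ≥0∞} (hp : 1 ≤ p) {F : ℕ → ℕ → ℝ≥0∞} (hF : Monotone F) :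
    seqNorm p (fun k => ⨆ n, F n k) = ⨆ n, seqNorm p (F n) := by
  rcases eq_or_ne p ∞ with rfl | hp'
  · simp only [seqNorm_top]
    exact iSup_comm
  · have hp0 : 0 < p.toReal := ENNReal.toReal_pos (zero_lt_one.trans_le hp).ne' hp'
    simp only [seqNorm_of_ne_top hp']
    have pow_iSup {q : ℝ} (hq : 0 < q) (g : ℕ → ℝ≥0∞) : (⨆ n, g n) ^ q = ⨆ n, g n ^ q :=
      (ENNReal.orderIsoRpow q hq).map_iSup g
    rw [← pow_iSup (one_div_pos.2 hp0)]
    congr 1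
    simp only [pow_iSup hp0, ← MeasureTheory.lintegral_count]
    refine MeasureTheory.lintegral_iSup (fun n => measurable_from_nat) fun m n h k => ?_
    exact ENNReal.rpow_le_rpow (hF h k) hp0.le

theorem seqNorm_add_le {p : ℝ≥0∞} (hp : 1 ≤ p) (x y : ℕ → ℝ≥0∞) :
    seqNorm p (fun k => x k + y k) ≤ seqNorm p x + seqNorm p y := by
  rcases eq_or_ne p ∞ with rfl | hp'
  · simp only [seqNorm_top]
    exact iSup_le fun k => add_le_add (le_iSup x k) (le_iSup y k)
  · have hp1 : 1 ≤ p.toReal := by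
      rw [← ENNReal.toReal_one]
      exact ENNReal.toReal_mono hp' hp
    simp only [seqNorm_of_ne_top hp', ← MeasureTheory.lintegral_count]
    exact ENNReal.lintegral_Lp_add_le measurable_from_nat.aemeasurable
      measurable_from_nat.aemeasurable hp1

/-- Minkowski's inequality for countable sums. -/
theorem seqNorm_tsum_le {p : ℝ≥0∞} (hp : 1 ≤ p) (M : ℕ → ℕ → ℝ≥0∞) :
    seqNorm p (fun k => ∑' j, M k j) ≤ ∑' j, seqNorm p fun k => M k j := by
  have h (n : ℕ) : seqNorm p (fun k => ∑ j ∈ Finset.range n, M k j) ≤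
      ∑ j ∈ Finset.range n, seqNorm p fun k => M k j := by
    induction n with
    | zero =>
      have hp0 : p ≠ 0 := (zero_lt_one.trans_le hp).ne'
      rcases eq_or_ne p ∞ with rfl | hp'
      · simp [seqNorm_top]
      · simp [seqNorm_of_ne_top hp', ENNReal.toReal_pos hp0 hp']
    | succ n ih =>
      simp only [Finset.sum_range_succ]
      exact (seqNorm_add_le hp _ _).trans (by gcongr)
  simp only [ENNReal.tsum_eq_iSup_nat]
  rw [seqNorm_iSup hp (F := fun n k => ∑ j ∈ Finset.range n, M k j)]
  · exact iSup_mono h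
  · intro m n hmn k
    exact Finset.sum_le_sum_of_subset (Finset.range_mono hmn)

/-- Hölder's inequality for `f ^ θ * g ^ (1 - θ)`, one of the exponents being `1`. -/
theorem seqNorm_rpow_mul_rpow_le {p r : ℝ≥0∞} (hp : 1 ≤ p) (hr : 1 ≤ r) {θ : ℝ}
    (h0 : 0 ≤ θ) (h1 : θ ≤ 1) (h : p⁻¹.toReal = θ + (1 - θ) * r⁻¹.toReal) (f g : ℕ → ℝ≥0∞) :
    seqNorm p (fun k => f k ^ θ * g k ^ (1 - θ)) ≤ seqNorm 1 f ^ θ * seqNorm r g ^ (1 - θ) := by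
  have hθ' : 0 ≤ 1 - θ := sub_nonneg.2 h1
  rcases eq_or_ne p ∞ with rfl | hp'
  · rw [seqNorm_top]
    refine iSup_le fun k => ?_
    gcongr
    · exact le_seqNorm le_rfl f k
    · exact le_seqNorm hr g k
  have hp0 : 0 < p.toReal := ENNReal.toReal_pos (zero_lt_one.trans_le hp).ne' hp'
  rw [seqNorm_of_ne_top hp', one_div, ENNReal.rpow_inv_le_iff hp0, seqNorm_one,
    ENNReal.mul_rpow_of_nonneg _ _ hp0.le, ← ENNReal.rpow_mul, ← ENNReal.rpow_mul]
  simp only [ENNReal.mul_rpow_of_nonneg _ _ hp0.le, ← ENNReal.rpow_mul]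
  rw [ENNReal.toReal_inv] at h
  rcases eq_or_ne r ∞ with rfl | hr'
  · have hθp : θ * p.toReal = 1 := by
      simp only [ENNReal.inv_top, ENNReal.toReal_zero, mul_zero, add_zero] at h
      rw [← h, inv_mul_cancel₀ hp0.ne']
    simp only [hθp, ENNReal.rpow_one]
    rw [← ENNReal.tsum_mul_right]
    refine ENNReal.tsum_le_tsum fun k => ?_
    gcongr
    exact le_seqNorm hr g k
  · have hr0 : 0 < r.toReal := ENNReal.toReal_pos (zero_lt_one.trans_le hr).ne' hr'
    rw [ENNReal.toReal_inv] at h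
    -- Multiplied by `p`, the relation `h` says that the Hölder weights `θ p` and `q` sum to `1`.
    set q := (1 - θ) * p.toReal / r.toReal with hq
    have hsum : θ * p.toReal + q = 1 := by
      rw [hq]
      field_simp at h ⊢
      linarith
    have hqr : (1 - θ) * p.toReal = r.toReal * q := by
      rw [hq]; field_simp
    rw [hqr, seqNorm_of_ne_top hr', ← ENNReal.rpow_mul, ← mul_assoc, one_div,
      inv_mul_cancel₀ hr0.ne', one_mul]
    simp only [ENNReal.rpow_mul _ r.toReal, ← MeasureTheory.lintegral_count]
    exact ENNReal.lintegral_mul_norm_pow_le measurable_from_nat.aemeasurable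
      measurable_from_nat.aemeasurable (by positivity) (by positivity) hsum

theorem seqNorm_le_rpow_mul_rpow {p r : ℝ≥0∞} (hp : 1 ≤ p) (hr : 1 ≤ r) {θ : ℝ}
    (h0 : 0 ≤ θ) (h1 : θ ≤ 1) (h : p⁻¹.toReal = θ + (1 - θ) * r⁻¹.toReal) (f : ℕ → ℝ≥0∞) :
    seqNorm p f ≤ seqNorm 1 f ^ θ * seqNorm r f ^ (1 - θ) := by
  refine le_trans (le_of_eq ?_) (seqNorm_rpow_mul_rpow_le hp hr h0 h1 h f f)
  congr 1
  ext k
  rw [← ENNReal.rpow_add_of_nonneg _ _ h0 (sub_nonneg.2 h1), add_sub_cancel, ENNReal.rpow_one]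

/-- Each term satisfies `x j ^ q ≤ x j ^ p * ‖x‖_p ^ (q - p)`. -/
theorem seqNorm_anti {p q : ℝ≥0∞} (hp : 1 ≤ p) (hpq : p ≤ q) (x : ℕ → ℝ≥0∞) :
    seqNorm q x ≤ seqNorm p x := by
  rcases eq_or_ne q ∞ with rfl | hq'
  · rw [seqNorm_top]
    exact iSup_le (le_seqNorm hp x)
  have hp' : p ≠ ∞ := (hpq.trans_lt hq'.lt_top).ne
  have hp0 : 0 < p.toReal := ENNReal.toReal_pos (zero_lt_one.trans_le hp).ne' hp'
  have hpq' : p.toReal ≤ q.toReal := ENNReal.toReal_mono hq' hpq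
  have hq0 : 0 < q.toReal := hp0.trans_le hpq'
  have split (t : ℝ≥0∞) : t ^ q.toReal = t ^ p.toReal * t ^ (q.toReal - p.toReal) := by
    rw [← ENNReal.rpow_add_of_nonneg _ _ hp0.le (sub_nonneg.2 hpq'), add_sub_cancel]
  rw [seqNorm_of_ne_top hq', one_div, ENNReal.rpow_inv_le_iff hq0, split (seqNorm p x)]
  have e : seqNorm p x ^ p.toReal = ∑' j, x j ^ p.toReal := by
    rw [seqNorm_of_ne_top hp', ← ENNReal.rpow_mul, one_div, inv_mul_cancel₀ hp0.ne',
      ENNReal.rpow_one]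
  rw [e, ← ENNReal.tsum_mul_right]
  refine ENNReal.tsum_le_tsum fun j => ?_
  rw [split]
  gcongr
  exact le_seqNorm hp x j

/-- A sequence cut off at `n`. -/
noncomputable def truncate (n : ℕ) (x : ℕ → ℝ≥0∞) (j : ℕ) : ℝ≥0∞ := if j < n then x j else 0

theorem seqNorm_eq_iSup_truncate {p : ℝ≥0∞} (hp : 1 ≤ p) (x : ℕ → ℝ≥0∞) :
    seqNorm p x = ⨆ n, seqNorm p (truncate n x) := by
  rw [← seqNorm_iSup hp]
  · congr 1
    ext j
    refine le_antisymm (le_iSup_of_le (j + 1) (by simp [truncate])) (iSup_le fun n => ?_)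
    unfold truncate
    split_ifs <;> simp
  · intro m n hmn j
    simp only [truncate]
    split_ifs <;> first | omega | simp

theorem seqNorm_truncate {p : ℝ≥0∞} (hp : 1 ≤ p) (hp' : p ≠ ∞) (n : ℕ) (x : ℕ → ℝ≥0∞) :
    seqNorm p (truncate n x) = (∑ i : Fin n, x i ^ p.toReal) ^ (1 / p.toReal) := by
  have hp0 : 0 < p.toReal := ENNReal.toReal_pos (zero_lt_one.trans_le hp).ne' hp'
  rw [seqNorm_of_ne_top hp', tsum_eq_sum (s := Finset.range n),
    Fin.sum_univ_eq_sum_range fun i => x i ^ p.toReal]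
  · congr 1
    refine Finset.sum_congr rfl fun j hj => ?_
    rw [truncate, if_pos (Finset.mem_range.1 hj)]
  · intro j hj
    rw [truncate, if_neg (by simpa using hj), ENNReal.zero_rpow_of_pos hp0]

theorem seqNorm_truncate_ofReal_abs_le {r : ℝ≥0∞} (hr : 2 ≤ r) (x : ℕ → ℝ) (n : ℕ) :
    seqNorm r (truncate n fun j => ENNReal.ofReal |x j|) ≤
      ENNReal.ofReal (2 ^ r⁻¹.toReal * cubeAvg fun ε : Fin n → Bool =>
        |rademacherSum (fun i => x i) ε|) := by
  have hr1 : 1 ≤ r := one_le_two.trans hr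
  rcases eq_or_ne r ∞ with rfl | hr'
  · rw [seqNorm_top]
    refine iSup_le fun j => ?_
    unfold truncate
    split_ifs with hj
    · refine ENNReal.ofReal_le_ofReal ?_
      simpa using abs_le_cubeAvg_abs_rademacherSum (fun i : Fin n => x i) ⟨j, hj⟩
    · exact zero_le
  · have hr2 : 2 ≤ r.toReal := by
      simpa using ENNReal.toReal_mono hr' hr
    have hr0 : 0 < r.toReal := by linarith
    have hE : 0 ≤ cubeAvg fun ε : Fin n → Bool => |rademacherSum (fun i => x i) ε| := by
      rw [← cubeAvg_const (n := n) 0]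
      exact cubeAvg_mono fun ε => abs_nonneg _
    rw [seqNorm_truncate hr1 hr', one_div, ENNReal.rpow_inv_le_iff hr0,
      ENNReal.ofReal_rpow_of_nonneg (by positivity) hr0.le,
      Real.mul_rpow (by positivity) hE, ← Real.rpow_mul zero_le_two, ENNReal.toReal_inv,
      inv_mul_cancel₀ hr0.ne', Real.rpow_one]
    simp only [ENNReal.ofReal_rpow_of_nonneg (abs_nonneg _) hr0.le]
    rw [← ENNReal.ofReal_sum_of_nonneg fun i _ => by positivity]
    exact ENNReal.ofReal_le_ofReal (sum_rpow_le_two_mul_rpow_cubeAvg _ hr2)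

/-! ### Bilinear forms on `c₀` and the endpoint estimates -/

namespace NullSeq

theorem smul_apply (c : ℝ) (x : NullSeq) (k : ℕ) : (c • x) k = c * x k := rfl

theorem abs_apply_le_norm (x : NullSeq) (k : ℕ) : |x k| ≤ ‖x‖ :=
  (ZeroAtInftyContinuousMap.toBCF (α := ℕ) (β := ℝ) x).norm_coe_le_norm k

theorem norm_le {x : NullSeq} {C : ℝ} (hC : 0 ≤ C) (h : ∀ k, |x k| ≤ C) : ‖x‖ ≤ C :=
  (BoundedContinuousFunction.norm_le
    (f := ZeroAtInftyContinuousMap.toBCF (α := ℕ) (β := ℝ) x) hC).2 h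

/-- Evaluation at a coordinate. -/
noncomputable def coord (k : ℕ) : NullSeq →L[ℝ] ℝ :=
  LinearMap.mkContinuous
    { toFun := fun x => x k, map_add' := fun _ _ => rfl, map_smul' := fun _ _ => rfl } 1
    fun x => by rw [one_mul]; exact abs_apply_le_norm x k

theorem coord_apply (k : ℕ) (x : NullSeq) : coord k x = x k := rfl

end NullSeq

theorem canonicalVec_apply (k m : ℕ) : canonicalVec k m = if m = k then 1 else 0 := by
  change (Pi.single k 1 : ℕ → ℝ) m = _
  simp [Pi.single_apply]

theorem norm_sum_smul_canonicalVec_le {ι : Type*} (s : Finset ι) {v : ι → ℕ}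
    (hv : Function.Injective v) {c : ι → ℝ} (hc : ∀ i, |c i| ≤ 1) :
    ‖∑ i ∈ s, c i • canonicalVec (v i)‖ ≤ 1 := by
  refine NullSeq.norm_le zero_le_one fun m => ?_
  rw [← NullSeq.coord_apply, map_sum]
  simp only [NullSeq.coord_apply, NullSeq.smul_apply, canonicalVec_apply]
  by_cases hm : ∃ i ∈ s, m = v i
  · obtain ⟨i, hi, rfl⟩ := hm
    rw [Finset.sum_eq_single_of_mem i hi fun j _ hj => by
      rw [if_neg fun h => hj (hv h).symm, mul_zero]]
    simpa using hc i
  · rw [Finset.sum_eq_zero fun i hi => by rw [if_neg fun h => hm ⟨i, hi, h⟩, mul_zero]]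
    simp

/-- `A` is tested on two unit-ball vectors: `y` with signs `ε`, and `x` with the signs of `A (e k)
y`. -/
theorem sum_abs_rademacherSum_le (A : BilinForm) (K : Finset ℕ) {n : ℕ} (ε : Fin n → Bool) :
    ∑ k ∈ K, |rademacherSum (fun i : Fin n => A (canonicalVec k) (canonicalVec i)) ε| ≤ ‖A‖ := by
  set y : NullSeq := ∑ i : Fin n, boolSign (ε i) • canonicalVec i with hy
  have hA (k : ℕ) : rademacherSum (fun i : Fin n => A (canonicalVec k) (canonicalVec i)) ε =
      A (canonicalVec k) y := by
    simp [hy, rademacherSum]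
  set x : NullSeq := ∑ k ∈ K, (SignType.sign (A (canonicalVec k) y) : ℝ) • canonicalVec k with hx
  have hxy : ∑ k ∈ K, |A (canonicalVec k) y| = A x y := by
    simp [hx, sign_mul_self]
  have hx1 : ‖x‖ ≤ 1 := norm_sum_smul_canonicalVec_le K Function.injective_id fun k => by
    rcases SignType.sign (A (canonicalVec k) y) <;> simp
  have hy1 : ‖y‖ ≤ 1 :=
    norm_sum_smul_canonicalVec_le Finset.univ Fin.val_injective fun i => (abs_boolSign _).le
  simp only [hA, hxy]
  calc A x y ≤ ‖A x y‖ := le_abs_self _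
    _ ≤ ‖A‖ * ‖x‖ * ‖y‖ := A.le_opNorm₂ x y
    _ ≤ ‖A‖ * 1 * 1 := by gcongr
    _ = ‖A‖ := by ring

/-- Khinchine in each row is summed over rows before averaging over signs; the bound is uniform in
the truncation. -/
theorem mixedNorm_one_right_le (A : BilinForm) {r : ℝ≥0∞} (hr : 2 ≤ r) :
    mixedNorm r 1 A ≤ ENNReal.ofReal (2 ^ r⁻¹.toReal * ‖A‖) := by
  have hr1 : 1 ≤ r := one_le_two.trans hr
  unfold mixedNorm
  rw [funext fun k => seqNorm_eq_iSup_truncate hr1 fun j =>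
      ENNReal.ofReal |A (canonicalVec k) (canonicalVec j)|,
    seqNorm_iSup le_rfl (F := fun n k => seqNorm r (truncate n fun j =>
    ENNReal.ofReal |A (canonicalVec k) (canonicalVec j)|))]
  · refine iSup_le fun n => ?_
    rw [seqNorm_one, ENNReal.tsum_eq_iSup_sum]
    refine iSup_le fun K => ?_
    refine (Finset.sum_le_sum fun k _ => seqNorm_truncate_ofReal_abs_le hr _ n).trans ?_
    have h0 (k : ℕ) : 0 ≤ cubeAvg fun ε : Fin n → Bool =>
        |rademacherSum (fun i => A (canonicalVec k) (canonicalVec i)) ε| := by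
      rw [← cubeAvg_const (n := n) 0]
      exact cubeAvg_mono fun ε => abs_nonneg _
    rw [← ENNReal.ofReal_sum_of_nonneg fun k _ => mul_nonneg (by positivity) (h0 k),
      ← Finset.mul_sum, ← cubeAvg_sum]
    refine ENNReal.ofReal_le_ofReal (mul_le_mul_of_nonneg_left ?_ (by positivity))
    rw [← cubeAvg_const (n := n) ‖A‖]
    exact cubeAvg_mono fun ε => sum_abs_rademacherSum_le A K ε
  · intro m n hmn k
    refine seqNorm_mono r fun j => ?_
    unfold truncate
    split_ifs <;> first | omega | simp

theorem mixedNorm_one_left_le (A : BilinForm) {r : ℝ≥0∞} (hr : 2 ≤ r) :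
    mixedNorm 1 r A ≤ ENNReal.ofReal (2 ^ r⁻¹.toReal * ‖A‖) := by
  have h := mixedNorm_one_right_le A.flip hr
  rw [ContinuousLinearMap.opNorm_flip] at h
  refine le_trans ?_ h
  unfold mixedNorm
  simp only [seqNorm_one, ContinuousLinearMap.flip_apply]
  exact seqNorm_tsum_le (one_le_two.trans hr) _

/-! ### Interpolation -/

theorem toReal_inv_le_one {a : ℝ≥0∞} (ha : 1 ≤ a) : a⁻¹.toReal ≤ 1 := by
  rw [← ENNReal.toReal_one]
  exact ENNReal.toReal_mono ENNReal.one_ne_top (ENNReal.inv_le_one.2 ha)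

theorem mixedNorm_le_of_one_le {a b : ℝ≥0∞} (ha : 1 ≤ a) (hb : 1 ≤ b)
    (h1 : 1 ≤ a⁻¹.toReal + b⁻¹.toReal) (h2 : a⁻¹.toReal + b⁻¹.toReal ≤ 3 / 2) (A : BilinForm) :
    mixedNorm a b A ≤ ENNReal.ofReal (2 ^ (a⁻¹.toReal + b⁻¹.toReal - 1) * ‖A‖) := by
  set u := a⁻¹.toReal with hu
  set v := b⁻¹.toReal with hv
  have hu1 : u ≤ 1 := toReal_inv_le_one ha
  have hv1 : v ≤ 1 := toReal_inv_le_one hb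
  set s := u + v - 1 with hs
  have hs0 : 0 ≤ s := by linarith
  have hs1 : 0 < 1 - s := by linarith
  -- For `s = 0` this is `∞`; the bound `s ≤ 1/2` gives `r ≥ 2`.
  set r : ℝ≥0∞ := (ENNReal.ofReal s)⁻¹ with hr
  have hrs : r⁻¹.toReal = s := by rw [hr, inv_inv, ENNReal.toReal_ofReal hs0]
  have hr2 : 2 ≤ r := by
    rw [hr, ENNReal.le_inv_iff_le_inv, ← ENNReal.ofReal_ofNat 2, ← ENNReal.ofReal_inv_of_pos two_pos]
    exact ENNReal.ofReal_le_ofReal (by linarith)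
  have hr1 : 1 ≤ r := one_le_two.trans hr2
  -- Solves `u = θ + (1 - θ) s` and `v = (1 - θ) + θ s` simultaneously.
  set θ := (1 - v) / (1 - s) with hθ
  have hθ0 : 0 ≤ θ := div_nonneg (by linarith) hs1.le
  have hθ1 : θ ≤ 1 := (div_le_one hs1).2 (by linarith)
  have hθs : θ * (1 - s) = 1 - v := div_mul_cancel₀ _ hs1.ne'
  have hinner : u = θ + (1 - θ) * r⁻¹.toReal := by rw [hrs]; linarith
  have houter : v = (1 - θ) + (1 - (1 - θ)) * r⁻¹.toReal := by rw [hrs]; linarith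
  have hl := mixedNorm_one_left_le A hr2
  have hrt := mixedNorm_one_right_le A hr2
  rw [hrs] at hl hrt
  set B := ENNReal.ofReal (2 ^ s * ‖A‖)
  calc mixedNorm a b A
      ≤ seqNorm b (fun k => seqNorm r (fun j => ENNReal.ofReal
          |A (canonicalVec k) (canonicalVec j)|) ^ (1 - θ) * seqNorm 1 (fun j => ENNReal.ofReal
          |A (canonicalVec k) (canonicalVec j)|) ^ (1 - (1 - θ))) := by
        refine seqNorm_mono b fun k => ?_
        rw [sub_sub_cancel, mul_comm]
        exact seqNorm_le_rpow_mul_rpow ha hr1 hθ0 hθ1 hinner _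
    _ ≤ mixedNorm r 1 A ^ (1 - θ) * mixedNorm 1 r A ^ (1 - (1 - θ)) :=
        seqNorm_rpow_mul_rpow_le hb hr1 (sub_nonneg.2 hθ1) (by linarith) houter _ _
    _ ≤ B ^ (1 - θ) * B ^ (1 - (1 - θ)) := by
        have : 0 ≤ 1 - θ := sub_nonneg.2 hθ1
        have : 0 ≤ 1 - (1 - θ) := by linarith
        gcongr
    _ = B := by
        rw [← ENNReal.rpow_add_of_nonneg _ _ (sub_nonneg.2 hθ1) (by linarith), add_sub_cancel,
          ENNReal.rpow_one]

theorem mixedNorm_le {a b : ℝ≥0∞} (ha : 1 ≤ a) (hb : 1 ≤ b) (hab : a⁻¹ + b⁻¹ ≤ 3 / 2)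
    (A : BilinForm) : mixedNorm a b A ≤ ENNReal.ofReal (littlewoodConst a b * ‖A‖) := by
  have ha' : a⁻¹ ≤ 1 := ENNReal.inv_le_one.2 ha
  have hb' : b⁻¹ ≤ 1 := ENNReal.inv_le_one.2 hb
  have hat : a⁻¹ ≠ ∞ := (ha'.trans_lt ENNReal.one_lt_top).ne
  have hbt : b⁻¹ ≠ ∞ := (hb'.trans_lt ENNReal.one_lt_top).ne
  unfold littlewoodConst
  rcases le_total 1 (a⁻¹ + b⁻¹) with h | h
  · have h1 : 1 ≤ a⁻¹.toReal + b⁻¹.toReal := by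
      rw [← ENNReal.toReal_add hat hbt, ← ENNReal.toReal_one]
      exact ENNReal.toReal_mono (ENNReal.add_ne_top.2 ⟨hat, hbt⟩) h
    have h2 : a⁻¹.toReal + b⁻¹.toReal ≤ 3 / 2 := by
      rw [← ENNReal.toReal_add hat hbt]
      refine (ENNReal.toReal_mono (by finiteness) hab).trans_eq ?_
      simp
    rw [max_eq_right (by linarith)]
    exact mixedNorm_le_of_one_le ha hb h1 h2 A
  · have hc : b⁻¹ ≤ 1 - a⁻¹ := ENNReal.le_sub_of_add_le_left hat h
    set c : ℝ≥0∞ := (1 - a⁻¹)⁻¹ with hc'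
    have hc1 : 1 ≤ c := ENNReal.one_le_inv.2 tsub_le_self
    have hcb : c ≤ b := by rw [hc', ENNReal.inv_le_iff_inv_le]; exact hc
    have hsum : a⁻¹.toReal + c⁻¹.toReal = 1 := by
      rw [hc', inv_inv, ENNReal.toReal_sub_of_le ha' ENNReal.one_ne_top, ENNReal.toReal_one]
      ring
    have h1 : a⁻¹.toReal + b⁻¹.toReal ≤ 1 := by
      rw [← ENNReal.toReal_add hat hbt, ← ENNReal.toReal_one]
      exact ENNReal.toReal_mono ENNReal.one_ne_top h
    have := mixedNorm_le_of_one_le ha hc1 hsum.ge (by rw [hsum]; norm_num) A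
    rw [hsum, sub_self] at this
    rw [max_eq_left (by linarith)]
    exact (seqNorm_anti hc1 hcb _).trans this

/-! ### Optimality of the constant -/

open NullSeq in
/-- The form `x 0 * y 0`. -/
noncomputable def rankOneForm : BilinForm := (coord 0).smulRight (coord 0)

open NullSeq in
/-- The form `x 0 * (y 0 + y 1) + x 1 * (y 0 - y 1)`. -/
noncomputable def hadamardForm : BilinForm :=
  (coord 0).smulRight (coord 0 + coord 1) + (coord 1).smulRight (coord 0 - coord 1)

theorem rankOneForm_apply (x y : NullSeq) : rankOneForm x y = x 0 * y 0 := rfl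

theorem hadamardForm_apply (x y : NullSeq) :
    hadamardForm x y = x 0 * (y 0 + y 1) + x 1 * (y 0 - y 1) := rfl

theorem norm_rankOneForm_le : ‖rankOneForm‖ ≤ 1 := by
  refine ContinuousLinearMap.opNorm_le_bound₂ _ zero_le_one fun x y => ?_
  rw [rankOneForm_apply, one_mul, Real.norm_eq_abs, abs_mul]
  gcongr <;> exact NullSeq.abs_apply_le_norm _ _

theorem norm_hadamardForm_le : ‖hadamardForm‖ ≤ 2 := by
  refine ContinuousLinearMap.opNorm_le_bound₂ _ zero_le_two fun x y => ?_
  rw [hadamardForm_apply, Real.norm_eq_abs]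
  have hx0 := NullSeq.abs_apply_le_norm x 0
  have hx1 := NullSeq.abs_apply_le_norm x 1
  have hy0 := NullSeq.abs_apply_le_norm y 0
  have hy1 := NullSeq.abs_apply_le_norm y 1
  have hy : |y 0 + y 1| + |y 0 - y 1| ≤ 2 * ‖y‖ := by
    rw [abs_le] at hy0 hy1
    rcases abs_cases (y 0 + y 1) with h | h <;> rcases abs_cases (y 0 - y 1) with h' | h' <;>
      linarith
  calc |x 0 * (y 0 + y 1) + x 1 * (y 0 - y 1)|
      ≤ |x 0| * |y 0 + y 1| + |x 1| * |y 0 - y 1| := by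
        rw [← abs_mul, ← abs_mul]
        exact abs_add_le _ _
    _ ≤ ‖x‖ * |y 0 + y 1| + ‖x‖ * |y 0 - y 1| := by gcongr
    _ = ‖x‖ * (|y 0 + y 1| + |y 0 - y 1|) := by ring
    _ ≤ ‖x‖ * (2 * ‖y‖) := by gcongr
    _ = 2 * ‖x‖ * ‖y‖ := by ring

theorem one_le_mixedNorm_rankOneForm {a b : ℝ≥0∞} (ha : 1 ≤ a) (hb : 1 ≤ b) :
    1 ≤ mixedNorm a b rankOneForm := by
  refine le_trans ?_ (le_seqNorm hb _ 0)
  refine le_trans ?_ (le_seqNorm ha _ 0)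
  simp [rankOneForm_apply, canonicalVec_apply]

/-- The norm of a sequence dominating `c` in its first two terms. -/
theorem two_rpow_mul_le_seqNorm {p : ℝ≥0∞} (hp : 1 ≤ p) {x : ℕ → ℝ≥0∞} {c : ℝ≥0∞}
    (h0 : c ≤ x 0) (h1 : c ≤ x 1) : 2 ^ p⁻¹.toReal * c ≤ seqNorm p x := by
  rcases eq_or_ne p ∞ with rfl | hp'
  · simpa using h0.trans (le_seqNorm hp x 0)
  · have hp0 : 0 < p.toReal := ENNReal.toReal_pos (zero_lt_one.trans_le hp).ne' hp'
    rw [seqNorm_of_ne_top hp', one_div, ENNReal.le_rpow_inv_iff hp0,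
      ENNReal.mul_rpow_of_nonneg _ _ hp0.le, ← ENNReal.rpow_mul, ENNReal.toReal_inv,
      inv_mul_cancel₀ hp0.ne', ENNReal.rpow_one]
    refine le_trans ?_ (ENNReal.sum_le_tsum (Finset.range 2))
    rw [Finset.sum_range_succ, Finset.sum_range_one, two_mul]
    gcongr

theorem two_rpow_le_mixedNorm_hadamardForm {a b : ℝ≥0∞} (ha : 1 ≤ a) (hb : 1 ≤ b) :
    2 ^ b⁻¹.toReal * 2 ^ a⁻¹.toReal ≤ mixedNorm a b hadamardForm := by
  refine two_rpow_mul_le_seqNorm hb ?_ ?_ <;>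
  · rw [← mul_one (2 ^ a⁻¹.toReal)]
    refine two_rpow_mul_le_seqNorm ha ?_ ?_ <;> simp [hadamardForm_apply, canonicalVec_apply]

/-- The four unit entries of `hadamardForm` give mixed norm at least `2 ^ (1/a + 1/b)` against norm
at most `2`. -/
theorem littlewoodConst_le {a b : ℝ≥0∞} (ha : 1 ≤ a) (hb : 1 ≤ b) {C : ℝ}
    (h : ∀ A : BilinForm, mixedNorm a b A ≤ ENNReal.ofReal (C * ‖A‖)) :
    littlewoodConst a b ≤ C := by
  have h1 := (one_le_mixedNorm_rankOneForm ha hb).trans (h rankOneForm)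
  rw [ENNReal.one_le_ofReal] at h1
  have hC0 : 0 ≤ C := by
    by_contra! hC
    have := mul_nonpos_of_nonpos_of_nonneg hC.le (norm_nonneg rankOneForm)
    linarith
  have hC1 : 1 ≤ C := by nlinarith [norm_rankOneForm_le]
  have h2 := (two_rpow_le_mixedNorm_hadamardForm ha hb).trans (h hadamardForm)
  rw [← ENNReal.ofReal_ofNat 2, ENNReal.ofReal_rpow_of_pos two_pos,
    ENNReal.ofReal_rpow_of_pos two_pos, ← ENNReal.ofReal_mul (by positivity),
    ENNReal.ofReal_le_ofReal_iff (by positivity), ← Real.rpow_add two_pos] at h2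
  unfold littlewoodConst
  rcases max_choice 0 (a⁻¹.toReal + b⁻¹.toReal - 1) with hm | hm
  · rw [hm, Real.rpow_zero]
    exact hC1
  · rw [hm, Real.rpow_sub_one two_ne_zero, div_le_iff₀ two_pos, add_comm]
    exact h2.trans (mul_le_mul_of_nonneg_left norm_hadamardForm_le hC0)

theorem theorem1p5 (a b : ℝ≥0∞) (ha : 1 ≤ a) (hb : 1 ≤ b) (hab : a⁻¹ + b⁻¹ ≤ 3 / 2) :
    (∀ A : BilinForm, mixedNorm a b A ≤ ENNReal.ofReal (littlewoodConst a b * ‖A‖)) ∧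
      ∀ C : ℝ, (∀ A : BilinForm, mixedNorm a b A ≤ ENNReal.ofReal (C * ‖A‖)) →
        littlewoodConst a b ≤ C :=
  ⟨mixedNorm_le ha hb hab, fun _ => littlewoodConst_le ha hb⟩
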